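/- For a complex square matrix $X$, let $\operatorname{ind}(X)$ be the smallest integer $k\ge 0$ with $\operatorname{rank}(X^k)=\operatorname{rank}(X^{k+1})$, let $X^d$ be the Drazin inverse of $X$, i.e. the unique matrix with $XX^d=X^dX$, $X^dXX^d=X^d$ and $X^{k}=X^{k+1}X^d$ for $k=\operatorname{ind}(X)$, and let $X^\pi=I-XX^d$. Let $A\in\mathbb{C}^{m\times m}$, $B\in\mathbb{C}^{m\times n}$, $C\in\mathbb{C}^{n\times m}$, $D\in\mathbb{C}^{n\times n}$, and put $$M=\begin{bmatrix}A&B\\C&D\end{bmatrix},\quad Z=D-CA^dB,\quad W=AA^d+A^dBCA^d,\quad P=\begin{bmatrix}A^2A^d&AA^dB\\CAA^d&CA^dB\end{bmatrix}.$$ Then $$P^d=\begin{bmatrix}I\\CA^d\end{bmatrix}\,[(AW)^d]^2A\,\begin{bmatrix}I&A^dB\end{bmatrix},$$ and the following hold (empty sums are $0$). (i) If $Z=0$ and $A^\pi BC=0$, then $$M^d=P^d+\sum_{k=0}^{g-1}(P^d)^{k+2}\begin{bmatrix}0&0\\CA^\pi&0\end{bmatrix}\begin{bmatrix}AA^\pi&A^\pi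 B\\0&0\end{bmatrix}^{k},\qquad\text{where } g=\operatorname{ind}(A)+1.$$ (ii) If $Z=0$ and $A^\pi B=0$, then $$M^d=P^d+\sum_{k=0}^{g-1}(P^d)^{k+2}\begin{bmatrix}0&0\\CA^\pi A^k&0\end{bmatrix},\qquad\text{where } g=\operatorname{ind}(A).$$ -/

import Mathlib

namespace Matrix

/-- The index of a square matrix: the least `k` with `rank (A ^ k) = rank (A ^ (k + 1))`. -/
noncomputable def drazinIndex {n : Type*} [Fintype n] [DecidableEq n] (A : Matrix n n ℂ) : ℕ :=
  sInf {k : ℕ | (A ^ k).rank = (A ^ (k + 1)).rank}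

/-- `X` satisfies the three defining equations of the Drazin inverse of `A`. -/
structure IsDrazinInverse {n : Type*} [Fintype n] [DecidableEq n] (A X : Matrix n n ℂ) : Prop where
  comm : A * X = X * A
  outer : X * A * X = X
  index : A ^ A.drazinIndex = A ^ (A.drazinIndex + 1) * X

theorem exists_commute_pow_eq {n : Type*} [Fintype n] [DecidableEq n] (A : Matrix n n ℂ) :
    ∃ (k : ℕ) (Y : Matrix n n ℂ), Commute A Y ∧ A ^ k = A ^ (k + 1) * Y := by
  obtain ⟨q, hq, hnd⟩ := Polynomial.exists_eq_pow_rootMultiplicity_mul_and_not_dvd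
    A.charpoly A.charpoly_monic.ne_zero 0
  set k := A.charpoly.rootMultiplicity 0
  rw [map_zero, sub_zero] at hq hnd
  have hc : q.coeff 0 ≠ 0 := fun h => hnd (Polynomial.X_dvd_iff.2 h)
  have h0 := A.aeval_self_charpoly
  rw [hq, ← Polynomial.divX_mul_X_add q] at h0
  simp only [map_mul, map_pow, map_add, Polynomial.aeval_X, Polynomial.aeval_C] at h0
  have hcomm : Commute A (Polynomial.aeval A q.divX) := by
    have h := (Commute.all Polynomial.X q.divX).map (Polynomial.aeval A)
    rwa [Polynomial.aeval_X] at h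
  refine ⟨k, (-(q.coeff 0)⁻¹) • Polynomial.aeval A q.divX, hcomm.smul_right _, ?_⟩
  rw [← hcomm.eq, mul_add, ← mul_assoc, ← pow_succ, Algebra.algebraMap_eq_smul_one,
    mul_smul_comm, mul_one] at h0
  rw [mul_smul_comm, eq_neg_of_add_eq_zero_left h0, smul_neg, neg_smul, neg_neg, smul_smul,
    inv_mul_cancel₀ hc, one_smul]

theorem rank_drazinIndex {n : Type*} [Fintype n] [DecidableEq n] (A : Matrix n n ℂ) :
    (A ^ A.drazinIndex).rank = (A ^ (A.drazinIndex + 1)).rank := by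
  refine Nat.sInf_mem (s := {k : ℕ | (A ^ k).rank = (A ^ (k + 1)).rank}) ?_
  obtain ⟨k, Y, -, h⟩ := A.exists_commute_pow_eq
  refine ⟨k, le_antisymm ?_ ?_⟩
  · conv_lhs => rw [h]
    exact rank_mul_le_left _ _
  · rw [pow_succ]
    exact rank_mul_le_left _ _

theorem pow_drazinIndex_mul_eq_zero {n : Type*} [Fintype n] [DecidableEq n]
    (A Y : Matrix n n ℂ) (h : A ^ (A.drazinIndex + 1) * Y = 0) : A ^ A.drazinIndex * Y = 0 := by
  set k := A.drazinIndex with hk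
  have hle : LinearMap.ker (A ^ k).mulVecLin ≤ LinearMap.ker (A ^ (k + 1)).mulVecLin := by
    intro v hv
    simp only [LinearMap.mem_ker, mulVecLin_apply] at hv ⊢
    rw [pow_succ', ← mulVec_mulVec, hv, mulVec_zero]
  have hr : (A ^ k).rank = (A ^ (k + 1)).rank := A.rank_drazinIndex
  have h1 := LinearMap.finrank_range_add_finrank_ker (A ^ k).mulVecLin
  have h2 := LinearMap.finrank_range_add_finrank_ker (A ^ (k + 1)).mulVecLin
  unfold rank at hr
  have heq := Submodule.eq_of_le_of_finrank_eq hle (by omega)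
  ext i j
  have hv : (Y.col j) ∈ LinearMap.ker (A ^ k).mulVecLin := by
    rw [heq]
    simp only [LinearMap.mem_ker, mulVecLin_apply]
    ext l
    exact congrFun (congrFun h l) j
  exact congrFun hv i

theorem pow_drazinIndex_mul_eq_zero_of_pow {n : Type*} [Fintype n] [DecidableEq n]
    (A Y : Matrix n n ℂ) (j : ℕ) (h : A ^ (A.drazinIndex + j) * Y = 0) :
    A ^ A.drazinIndex * Y = 0 := by
  induction j with
  | zero => simpa using h
  | succ j ih =>
    apply ih
    have h' : A ^ (A.drazinIndex + 1) * (A ^ j * Y) = 0 := by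
      rw [← mul_assoc, ← pow_add, ← h]
      congr 2
      omega
    rw [pow_add, mul_assoc]
    exact pow_drazinIndex_mul_eq_zero A _ h'

/-- Every complex square matrix has exactly one Drazin inverse. -/
theorem existsUnique_isDrazinInverse {n : Type*} [Fintype n] [DecidableEq n]
    (A : Matrix n n ℂ) : ∃! X, A.IsDrazinInverse X := by
  apply existsUnique_of_exists_of_unique
  · obtain ⟨k, Y, hc, h⟩ := A.exists_commute_pow_eq
    have hp : ∀ j, A ^ k = A ^ (k + j) * Y ^ j := by
      intro j
      induction j with
      | zero => simp
      | succ j ih =>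
        calc A ^ k = A ^ (k + j) * Y ^ j := ih
          _ = A ^ j * A ^ k * Y ^ j := by rw [← pow_add, add_comm j]
          _ = A ^ j * (A ^ (k + 1) * Y) * Y ^ j := by rw [← h]
          _ = A ^ (k + (j + 1)) * Y ^ (j + 1) := by
            rw [← mul_assoc, ← pow_add, mul_assoc, ← pow_succ']
            congr 2
            omega
    have hX : Commute A (A ^ k * Y ^ (k + 1)) :=
      ((Commute.refl A).pow_right k).mul_right (hc.pow_right _)
    refine ⟨A ^ k * Y ^ (k + 1), hX.eq, ?_, ?_⟩
    · calc A ^ k * Y ^ (k + 1) * A * (A ^ k * Y ^ (k + 1))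
          = A * (A ^ k * Y ^ (k + 1)) * (A ^ k * Y ^ (k + 1)) := by rw [hX.eq]
        _ = A ^ (k + 1) * (Y ^ (k + 1) * A ^ k) * Y ^ (k + 1) := by
            rw [pow_succ' A k]; noncomm_ring
        _ = A ^ (k + 1) * (A ^ k * Y ^ (k + 1)) * Y ^ (k + 1) := by
            rw [(hc.pow_pow k (k + 1)).eq]
        _ = A ^ (k + (k + 1)) * Y ^ (k + 1) * Y ^ (k + 1) := by
            rw [← mul_assoc (A ^ (k + 1)), ← pow_add, add_comm (k + 1)]
        _ = A ^ k * Y ^ (k + 1) := by rw [← hp]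
    · have hz : A ^ A.drazinIndex * (1 - A * (A ^ k * Y ^ (k + 1))) = 0 := by
        apply pow_drazinIndex_mul_eq_zero_of_pow A _ k
        rw [pow_add, mul_assoc]
        have : A ^ k * (1 - A * (A ^ k * Y ^ (k + 1))) = 0 := by
          rw [mul_sub, mul_one, ← mul_assoc A, ← mul_assoc (A ^ k), ← pow_succ', ← pow_add, ← hp,
            sub_self]
        rw [this, mul_zero]
      rw [mul_sub, mul_one, ← mul_assoc, ← pow_succ, sub_eq_zero] at hz
      exact hz
  · intro X Y hX hY
    set k := A.drazinIndex with hk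
    have key : ∀ X : Matrix n n ℂ, A.IsDrazinInverse X → ∀ j,
        X = X ^ (j + 1) * A ^ j ∧ Commute A X := by
      intro X hX j
      refine ⟨?_, hX.comm⟩
      induction j with
      | zero => simp
      | succ j ih =>
        have hc : Commute A X := hX.comm
        calc X = X * A * X := hX.outer.symm
          _ = X * A * (X ^ (j + 1) * A ^ j) := by rw [← ih]
          _ = X * (A * X ^ (j + 1)) * A ^ j := by noncomm_ring
          _ = X * (X ^ (j + 1) * A) * A ^ j := by rw [(hc.pow_right (j + 1)).eq]
          _ = X ^ (j + 1 + 1) * A ^ (j + 1) := by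
            rw [pow_succ' X (j + 1), pow_succ' A j]; noncomm_ring
    have hcX : Commute A X := hX.comm
    have hcY : Commute A Y := hY.comm
    have hXk := (key X hX k).1
    have hYk := (key Y hY k).1
    have e1 : X = X * A * Y := by
      calc X = X ^ (k + 1) * A ^ k := hXk
        _ = X ^ (k + 1) * (A ^ (k + 1) * Y) := by rw [← hY.index]
        _ = X ^ (k + 1) * A ^ k * A * Y := by rw [pow_succ A k]; noncomm_ring
        _ = X * A * Y := by rw [← hXk]
    have e2 : Y = X * A * Y := by
      calc Y = Y ^ (k + 1) * A ^ k := hYk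
        _ = A ^ k * Y ^ (k + 1) := ((hcY.pow_pow k (k + 1)).eq).symm
        _ = A ^ (k + 1) * X * Y ^ (k + 1) := by rw [← hX.index]
        _ = X * A ^ (k + 1) * Y ^ (k + 1) := by rw [(hcX.pow_left (k + 1)).eq]
        _ = X * A * (A ^ k * Y ^ (k + 1)) := by rw [pow_succ' A k]; noncomm_ring
        _ = X * A * (Y ^ (k + 1) * A ^ k) := by rw [(hcY.pow_pow k (k + 1)).eq]
        _ = X * A * Y := by rw [← hYk]
    rw [e1, ← e2]

/-- The Drazin inverse `A^d` of a complex square matrix. -/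
noncomputable def drazinInv {n : Type*} [Fintype n] [DecidableEq n] (A : Matrix n n ℂ) :
    Matrix n n ℂ :=
  A.existsUnique_isDrazinInverse.choose

theorem isDrazinInverse_drazinInv {n : Type*} [Fintype n] [DecidableEq n] (A : Matrix n n ℂ) :
    A.IsDrazinInverse A.drazinInv :=
  A.existsUnique_isDrazinInverse.choose_spec.1

/-- `A^π = I - A A^d`. -/
noncomputable def drazinPi {n : Type*} [Fintype n] [DecidableEq n] (A : Matrix n n ℂ) :
    Matrix n n ℂ :=
  1 - A * A.drazinInv

/-- The generalized Schur complement `Z = D - C A^d B`. -/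
noncomputable def schurZ {m n : Type*} [Fintype m] [DecidableEq m]
    (A : Matrix m m ℂ) (B : Matrix m n ℂ) (C : Matrix n m ℂ) (D : Matrix n n ℂ) : Matrix n n ℂ :=
  D - C * A.drazinInv * B

/-- `W = A A^d + A^d B C A^d`. -/
noncomputable def blockW {m n : Type*} [Fintype m] [DecidableEq m] [Fintype n]
    (A : Matrix m m ℂ) (B : Matrix m n ℂ) (C : Matrix n m ℂ) : Matrix m m ℂ :=
  A * A.drazinInv + A.drazinInv * B * C * A.drazinInv

/-- `P = [A² A^d, A A^d B; C A A^d, C A^d B]`. -/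
noncomputable def blockP {m n : Type*} [Fintype m] [DecidableEq m]
    (A : Matrix m m ℂ) (B : Matrix m n ℂ) (C : Matrix n m ℂ) : Matrix (m ⊕ n) (m ⊕ n) ℂ :=
  fromBlocks (A ^ 2 * A.drazinInv) (A * A.drazinInv * B)
    (C * A * A.drazinInv) (C * A.drazinInv * B)

end Matrix

/-! Write `M = P + Q` with `Q = Q₁ + Q₂`, where `Q₁` has top row `A A^π, A^π B` and `Q₂` has only
the corner `C A^π`; `Z = 0` says exactly that the lower right corners agree. From `A^π A^d = 0` and
`A^π B C = 0` follow `Q P = 0`, `P Q₁ = 0` and `Q Q₂ = 0`, and `Q` is nilpotent because `A A^π` is.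
Then `M^d = ∑ (P^d)^(k+1) Q^k` (`drazinInv_add_of_mul_eq_zero`). As `Q^(k+1) = Q Q₁^k` and `P^d Q₁ =
0`, only `Q₂ Q₁^k` survives in each later term (`drazinInv_add_add`). The formula for `P^d` is
Cline's formula (`drazinInv_mul`) for a factorization `P = U V` with `V U = A W`. -/

namespace Matrix

/-! ### Drazin inverses of products and sums. -/

section Drazin

variable {n : Type*} [Fintype n] [DecidableEq n]

/-- The power equation of the Drazin inverse may be checked at any exponent. -/
theorem drazinInv_eq_of_pow {A X : Matrix n n ℂ} (hc : A * X = X * A) (ho : X * A * X = X)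
    (k : ℕ) (hk : A ^ (k + 1) * X = A ^ k) : A.drazinInv = X := by
  refine A.existsUnique_isDrazinInverse.unique A.isDrazinInverse_drazinInv ⟨hc, ho, ?_⟩
  have hz : A ^ A.drazinIndex * (1 - A * X) = 0 := by
    apply pow_drazinIndex_mul_eq_zero_of_pow A _ k
    rw [pow_add, mul_assoc, mul_sub, mul_one, ← mul_assoc (A ^ k), ← pow_succ, hk, sub_self,
      mul_zero]
  rwa [mul_sub, mul_one, ← mul_assoc, ← pow_succ, sub_eq_zero] at hz

theorem drazinInv_comm (A : Matrix n n ℂ) : A * A.drazinInv = A.drazinInv * A :=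
  A.isDrazinInverse_drazinInv.comm

theorem drazinInv_mul_mul_drazinInv (A : Matrix n n ℂ) :
    A.drazinInv * (A * A.drazinInv) = A.drazinInv := by
  rw [← mul_assoc, A.isDrazinInverse_drazinInv.outer]

theorem mul_drazinInv_mul_drazinInv (A : Matrix n n ℂ) :
    A * A.drazinInv * A.drazinInv = A.drazinInv := by
  rw [drazinInv_comm, A.isDrazinInverse_drazinInv.outer]

theorem mul_drazinInv_idem (A : Matrix n n ℂ) :
    A * A.drazinInv * (A * A.drazinInv) = A * A.drazinInv := by
  rw [mul_assoc, drazinInv_mul_mul_drazinInv]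

theorem pow_drazinIndex_succ_mul_drazinInv (A : Matrix n n ℂ) :
    A ^ (A.drazinIndex + 1) * A.drazinInv = A ^ A.drazinIndex :=
  A.isDrazinInverse_drazinInv.index.symm

theorem commute_drazinPi (A : Matrix n n ℂ) : Commute A A.drazinPi := by
  have h : Commute A A.drazinInv := A.drazinInv_comm
  exact (Commute.one_right A).sub_right ((Commute.refl A).mul_right h)

theorem drazinPi_mul_self (A : Matrix n n ℂ) : A.drazinPi * A.drazinPi = A.drazinPi := by
  simp only [drazinPi, mul_sub, sub_mul, mul_one, one_mul, mul_drazinInv_idem, sub_self, sub_zero]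

theorem drazinPi_mul_drazinInv (A : Matrix n n ℂ) : A.drazinPi * A.drazinInv = 0 := by
  rw [drazinPi, sub_mul, one_mul, mul_drazinInv_mul_drazinInv, sub_self]

theorem drazinInv_mul_drazinPi (A : Matrix n n ℂ) : A.drazinInv * A.drazinPi = 0 := by
  rw [drazinPi, mul_sub, mul_one, drazinInv_mul_mul_drazinInv, sub_self]

theorem drazinPi_mul_mul_drazinInv (A : Matrix n n ℂ) :
    A.drazinPi * (A * A.drazinInv) = 0 := by
  rw [drazinInv_comm, ← mul_assoc, drazinPi_mul_drazinInv, zero_mul]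

theorem mul_drazinInv_mul_drazinPi (A : Matrix n n ℂ) : A * A.drazinInv * A.drazinPi = 0 := by
  rw [mul_assoc, drazinInv_mul_drazinPi, mul_zero]

theorem pow_drazinIndex_mul_drazinPi (A : Matrix n n ℂ) :
    A ^ A.drazinIndex * A.drazinPi = 0 := by
  rw [drazinPi, mul_sub, mul_one, ← mul_assoc, ← pow_succ, pow_drazinIndex_succ_mul_drazinInv,
    sub_self]

theorem mul_drazinPi_pow_mul_drazinPi (A : Matrix n n ℂ) (k : ℕ) :
    (A * A.drazinPi) ^ k * A.drazinPi = A ^ k * A.drazinPi := by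
  induction k with
  | zero => simp
  | succ k ih =>
    rw [pow_succ', mul_assoc, ih, pow_succ', mul_assoc A, ← mul_assoc A.drazinPi,
      ← (A.commute_drazinPi.pow_left k).eq, mul_assoc (A ^ k), drazinPi_mul_self, ← mul_assoc]

theorem drazinInv_mul_eq_zero {m : Type*} {P : Matrix n n ℂ} {X : Matrix n m ℂ}
    (h : P * X = 0) : P.drazinInv * X = 0 := by
  rw [← P.isDrazinInverse_drazinInv.outer, Matrix.mul_assoc, Matrix.mul_assoc,
    ← Matrix.mul_assoc P, drazinInv_comm, Matrix.mul_assoc P.drazinInv, h, Matrix.mul_zero,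
    Matrix.mul_zero]

theorem mul_drazinInv_eq_zero {m : Type*} {P : Matrix n n ℂ} {X : Matrix m n ℂ}
    (h : X * P = 0) : X * P.drazinInv = 0 := by
  rw [← P.isDrazinInverse_drazinInv.outer, ← drazinInv_comm, Matrix.mul_assoc,
    ← Matrix.mul_assoc, h, Matrix.zero_mul]

/-- Cline's formula. -/
theorem drazinInv_mul {m : Type*} [Fintype m] [DecidableEq m]
    (U : Matrix n m ℂ) (V : Matrix m n ℂ) :
    (U * V).drazinInv = U * (V * U).drazinInv ^ 2 * V := by
  set R := V * U with hR
  set d := R.drazinInv with hd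
  have hRd : R * d ^ 2 = d := by
    rw [pow_two, ← mul_assoc, mul_drazinInv_mul_drazinInv]
  have hdR : d ^ 2 * R = d := by
    rw [pow_two, mul_assoc, ← drazinInv_comm, drazinInv_mul_mul_drazinInv]
  have hl : U * V * (U * d ^ 2 * V) = U * d * V := by
    calc U * V * (U * d ^ 2 * V) = U * (V * U * d ^ 2) * V := by simp only [Matrix.mul_assoc]
      _ = U * d * V := by rw [← hR, hRd]
  have hr : U * d ^ 2 * V * (U * V) = U * d * V := by
    calc U * d ^ 2 * V * (U * V) = U * (d ^ 2 * (V * U)) * V := by simp only [Matrix.mul_assoc]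
      _ = U * d * V := by rw [← hR, hdR]
  have hpow : ∀ k, (U * V) ^ (k + 1) = U * R ^ k * V := by
    intro k
    induction k with
    | zero => simp
    | succ k ih =>
      rw [pow_succ, ih, pow_succ, hR]
      simp only [Matrix.mul_assoc]
  -- One power beyond the index of `V * U`, since `(U * V) ^ (k + 1)` contains only `R ^ k`.
  refine drazinInv_eq_of_pow (hl.trans hr.symm) ?_ (R.drazinIndex + 1) ?_
  · calc U * d ^ 2 * V * (U * V) * (U * d ^ 2 * V) = U * d * V * (U * d ^ 2 * V) := by rw [hr]
      _ = U * (d * (V * U * d ^ 2)) * V := by simp only [Matrix.mul_assoc]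
      _ = U * d ^ 2 * V := by rw [← hR, hRd, pow_two]
  · rw [pow_succ, Matrix.mul_assoc, hl, hpow]
    calc U * R ^ R.drazinIndex * V * (U * d * V)
        = U * (R ^ R.drazinIndex * (V * U) * d) * V := by simp only [Matrix.mul_assoc]
      _ = U * R ^ R.drazinIndex * V := by
        rw [← hR, ← pow_succ, pow_drazinIndex_succ_mul_drazinInv]

/-- The Drazin inverse of `P + Q` when `Q * P = 0` and `Q` is nilpotent. -/
theorem drazinInv_add_of_mul_eq_zero {P Q : Matrix n n ℂ} (hQP : Q * P = 0) {N : ℕ}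
    (hN : Q ^ (N + 1) = 0) :
    (P + Q).drazinInv = ∑ k ∈ Finset.range (N + 1), P.drazinInv ^ (k + 1) * Q ^ k := by
  set d := P.drazinInv with hd
  set S := ∑ k ∈ Finset.range (N + 1), d ^ (k + 1) * Q ^ k with hS
  have hQd : Q * d = 0 := mul_drazinInv_eq_zero hQP
  have hQS : Q * S = 0 := by
    rw [hS, Finset.mul_sum]
    refine Finset.sum_eq_zero fun k _ => ?_
    rw [pow_succ', mul_assoc d, ← mul_assoc Q, hQd, zero_mul]
  -- Every term of `S` but the one at `k = 0` ends in `Q`.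
  have hSx : ∀ X : Matrix n n ℂ, Q * X = 0 → S * X = d * X := by
    intro X hX
    rw [hS, Finset.sum_range_succ', add_mul, Finset.sum_mul, Finset.sum_eq_zero, zero_add]
    · simp
    · intro k _
      rw [pow_succ Q, mul_assoc, mul_assoc, hX, mul_zero, mul_zero]
  have hMS : (P + Q) * S = P * S := by rw [add_mul, hQS, add_zero]
  have hSM : S * (P + Q) = P * S := by
    have hSQ : S * Q = ∑ k ∈ Finset.range N, d ^ (k + 1) * Q ^ (k + 1) := by
      rw [hS, Finset.sum_mul, Finset.sum_range_succ, mul_assoc _ _ Q, ← pow_succ, hN, mul_zero,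
        add_zero]
      exact Finset.sum_congr rfl fun k _ => by rw [mul_assoc, ← pow_succ]
    have hPS : P * S = (∑ k ∈ Finset.range N, d ^ (k + 1) * Q ^ (k + 1)) + P * d := by
      rw [hS, Finset.sum_range_succ', mul_add, Finset.mul_sum, zero_add, pow_one, pow_zero,
        mul_one]
      congr 1
      refine Finset.sum_congr rfl fun k _ => ?_
      rw [pow_succ' d (k + 1), pow_succ' d k, ← mul_assoc, ← mul_assoc, ← mul_assoc, hd,
        mul_drazinInv_mul_drazinInv]
    rw [mul_add, hSx P hQP, hSQ, hPS, add_comm, hd, drazinInv_comm]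
  have hdPS : d * (P * S) = S := by
    rw [hS, Finset.mul_sum, Finset.mul_sum]
    refine Finset.sum_congr rfl fun k _ => ?_
    rw [pow_succ' d k, ← mul_assoc, ← mul_assoc, ← mul_assoc,
      P.isDrazinInverse_drazinInv.outer]
  have hQM : ∀ j, Q * (P + Q) ^ j = Q ^ (j + 1) := by
    intro j
    induction j with
    | zero => simp
    | succ j ih => rw [pow_succ, ← mul_assoc, ih, mul_add, pow_succ, mul_assoc, hQP, mul_zero,
        zero_add, ← pow_succ, ← pow_succ]
  -- After `N` factors `P + Q`, a further `Q` on the left would give at least `Q ^ (N + 1) = 0`, so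
  -- each new left factor acts as `P`.
  have hMP : ∀ i, (P + Q) ^ (i + N) = P ^ i * (P + Q) ^ N := by
    intro i
    induction i with
    | zero => simp
    | succ i ih =>
      have h0 : Q * (P + Q) ^ (i + N) = 0 := by
        rw [hQM, show i + N + 1 = N + 1 + i by omega, pow_add, hN, zero_mul]
      rw [show i + 1 + N = (i + N) + 1 by omega, pow_succ', add_mul, h0, add_zero, ih,
        ← mul_assoc, ← pow_succ']
  have hcomm : Commute (P + Q) S := hMS.trans hSM.symm
  -- `N` factors exhaust `Q`, and `P.drazinIndex` serves the power equation of `P`; the extra 1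
  -- ensures `Q * P ^ (P.drazinIndex + 1) = 0` even at index 0.
  refine drazinInv_eq_of_pow hcomm.eq ?_ (P.drazinIndex + 1 + N) ?_
  · rw [mul_assoc, hMS, hSx _ (by rw [← mul_assoc, hQP, zero_mul]), hdPS]
  · have h0 : Q * P ^ (P.drazinIndex + 1) = 0 := by rw [pow_succ', ← mul_assoc, hQP, zero_mul]
    have hPd : P * (d * P ^ (P.drazinIndex + 1)) = P ^ (P.drazinIndex + 1) := by
      have hc : Commute P d := P.drazinInv_comm
      rw [← (hc.pow_left _).eq, pow_drazinIndex_succ_mul_drazinInv, ← pow_succ']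
    rw [(hcomm.pow_left _).eq, pow_succ', ← mul_assoc, hSM, hMP, mul_assoc, ← mul_assoc S,
      hSx _ h0, ← mul_assoc, hPd]

/-- The Drazin inverse of `P + (Q₁ + Q₂)` when `Q₁ + Q₂` annihilates `P` and `Q₂` from the left
and `P` annihilates `Q₁` from the left. -/
theorem drazinInv_add_add {P Q₁ Q₂ : Matrix n n ℂ} (hQP : (Q₁ + Q₂) * P = 0) (hPQ : P * Q₁ = 0)
    (hQ : (Q₁ + Q₂) * Q₂ = 0) {g : ℕ} (hg : (Q₁ + Q₂) * Q₁ ^ g = 0) :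
    (P + (Q₁ + Q₂)).drazinInv =
      P.drazinInv + ∑ k ∈ Finset.range g, P.drazinInv ^ (k + 2) * Q₂ * Q₁ ^ k := by
  have hpow : ∀ k, (Q₁ + Q₂) ^ (k + 1) = (Q₁ + Q₂) * Q₁ ^ k := by
    intro k
    induction k with
    | zero => simp
    | succ k ih =>
      rw [pow_succ', ih, ← mul_assoc, mul_add, hQ, add_zero, pow_succ', ← mul_assoc]
  rw [drazinInv_add_of_mul_eq_zero hQP ((hpow g).trans hg), Finset.sum_range_succ', add_comm]
  congr 1
  · simp
  -- The last factor `P.drazinInv` meets `Q₁ + Q₂` and removes `Q₁`.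
  · refine Finset.sum_congr rfl fun k _ => ?_
    rw [hpow, ← mul_assoc, mul_add, pow_succ _ (k + 1), mul_assoc _ _ Q₁,
      drazinInv_mul_eq_zero hPQ, mul_zero, zero_add]

end Drazin

/-! ### Block matrices: the inverse of `P` and the splitting of `M`. -/

section Block

variable {m n : Type*} [Fintype m] [DecidableEq m]

/-- The factors are arranged so that their product in reverse order is `A * blockW A B C`. -/
theorem blockP_eq_mul (A : Matrix m m ℂ) (B : Matrix m n ℂ) (C : Matrix n m ℂ) :
    blockP A B C = fromRows (1 : Matrix m m ℂ) (C * A.drazinInv) *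
      (A * (A * A.drazinInv) * fromCols (1 : Matrix m m ℂ) (A.drazinInv * B)) := by
  have h1 : A * (A * A.drazinInv) * A.drazinInv = A * A.drazinInv := by
    rw [mul_assoc, mul_drazinInv_mul_drazinInv]
  have h2 : A.drazinInv * (A * (A * A.drazinInv)) = A * A.drazinInv := by
    rw [← mul_assoc, ← drazinInv_comm, mul_drazinInv_idem]
  rw [mul_fromCols, fromRows_mul_fromCols, blockP]
  congr 1
  · rw [Matrix.one_mul, Matrix.mul_one, pow_two, mul_assoc]
  · rw [Matrix.one_mul, ← Matrix.mul_assoc, h1]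
  · rw [Matrix.mul_one, Matrix.mul_assoc C A.drazinInv, h2, Matrix.mul_assoc]
  · rw [← Matrix.mul_assoc _ A.drazinInv B, h1, ← Matrix.mul_assoc,
      Matrix.mul_assoc C A.drazinInv (A * _), drazinInv_mul_mul_drazinInv]

variable [Fintype n] [DecidableEq n]

theorem drazinInv_blockP (A : Matrix m m ℂ) (B : Matrix m n ℂ) (C : Matrix n m ℂ) :
    (blockP A B C).drazinInv = fromRows (1 : Matrix m m ℂ) (C * A.drazinInv) *
      (A * blockW A B C).drazinInv ^ 2 * A *
      fromCols (1 : Matrix m m ℂ) (A.drazinInv * B) := by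
  have hW : A * (A * A.drazinInv) * fromCols (1 : Matrix m m ℂ) (A.drazinInv * B) *
      fromRows (1 : Matrix m m ℂ) (C * A.drazinInv) = A * blockW A B C := by
    rw [Matrix.mul_assoc, fromCols_mul_fromRows, Matrix.one_mul, blockW, mul_assoc A]
    congr 1
    rw [Matrix.mul_add, Matrix.mul_one]
    congr 1
    simp only [← Matrix.mul_assoc]
    rw [mul_drazinInv_mul_drazinInv]
  have hz : A * blockW A B C * A.drazinPi = 0 := by
    rw [blockW, Matrix.mul_assoc, Matrix.add_mul, mul_drazinInv_mul_drazinPi,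
      Matrix.mul_assoc _ A.drazinInv, drazinInv_mul_drazinPi, Matrix.mul_zero, add_zero, Matrix.mul_zero]
  -- Cline's formula leaves `A * (A * A.drazinInv)` in the middle; the projection can be dropped
  -- because `A W`, hence its Drazin inverse, kills `A^π` on its right.
  have hd : (A * blockW A B C).drazinInv ^ 2 * (A * (A * A.drazinInv)) =
      (A * blockW A B C).drazinInv ^ 2 * A := by
    have h := drazinInv_mul_eq_zero hz
    have h' : (A * blockW A B C).drazinInv ^ 2 * (A * A.drazinPi) = 0 := by
      rw [A.commute_drazinPi.eq, ← mul_assoc, pow_two, mul_assoc _ _ A.drazinPi, h, mul_zero,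
        zero_mul]
    rw [drazinPi, mul_sub, mul_one, mul_sub, sub_eq_zero] at h'
    exact h'.symm
  rw [blockP_eq_mul, drazinInv_mul, hW, ← Matrix.mul_assoc, Matrix.mul_assoc (fromRows _ _), hd,
    ← Matrix.mul_assoc (fromRows _ _)]

theorem fromBlocks_zero_zero_pow_succ (X : Matrix m m ℂ) (Y : Matrix m n ℂ) (k : ℕ) :
    fromBlocks X Y 0 (0 : Matrix n n ℂ) ^ (k + 1) = fromBlocks (X ^ (k + 1)) (X ^ k * Y) 0 0 := by
  induction k with
  | zero => simp
  | succ k ih =>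
    rw [pow_succ', ih, fromBlocks_multiply]
    simp [← Matrix.mul_assoc, ← pow_succ']

/-- The off-diagonal block of a power lags one exponent behind the diagonal one, hence the `+ 1`. -/
theorem fromBlocks_drazinPi_pow_eq_zero (A : Matrix m m ℂ) (B : Matrix m n ℂ) :
    fromBlocks (A * A.drazinPi) (A.drazinPi * B) 0 (0 : Matrix n n ℂ) ^ (A.drazinIndex + 1) =
      0 := by
  have h : (A * A.drazinPi) ^ A.drazinIndex * A.drazinPi = 0 := by
    rw [mul_drazinPi_pow_mul_drazinPi, pow_drazinIndex_mul_drazinPi]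
  rw [fromBlocks_zero_zero_pow_succ, ← Matrix.mul_assoc, h, pow_succ, A.commute_drazinPi.eq,
    ← mul_assoc, ← A.commute_drazinPi.eq, h, zero_mul, Matrix.zero_mul, fromBlocks_zero]

theorem fromBlocks_mul_fromBlocks_drazinPi_pow (A : Matrix m m ℂ) (C : Matrix n m ℂ) (k : ℕ) :
    fromBlocks (0 : Matrix m m ℂ) (0 : Matrix m n ℂ) (C * A.drazinPi) 0 *
      fromBlocks (A * A.drazinPi) 0 0 0 ^ k = fromBlocks 0 0 (C * A.drazinPi * A ^ k) 0 := by
  induction k with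
  | zero => simp
  | succ k ih =>
    have h : C * A.drazinPi * A ^ k * (A * A.drazinPi) = C * A.drazinPi * A ^ (k + 1) := by
      rw [Matrix.mul_assoc, ← mul_assoc (A ^ k), ← pow_succ,
        (A.commute_drazinPi.pow_left (k + 1)).eq, ← Matrix.mul_assoc, Matrix.mul_assoc C,
        drazinPi_mul_self]
    rw [pow_succ, ← mul_assoc, ih, fromBlocks_multiply]
    simp [h]

/-- The expansion of the Drazin inverse of a block matrix with vanishing generalized Schur
complement and `A^π B C = 0`, for any admissible number of terms. -/
theorem drazinInv_fromBlocks {A : Matrix m m ℂ} {B : Matrix m n ℂ} {C : Matrix n m ℂ}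
    {D : Matrix n n ℂ} (hZ : schurZ A B C D = 0) (hB : A.drazinPi * B * C = 0) {g : ℕ}
    (hg : (fromBlocks (A * A.drazinPi) (A.drazinPi * B) 0 0 +
      fromBlocks 0 0 (C * A.drazinPi) (0 : Matrix n n ℂ)) *
        fromBlocks (A * A.drazinPi) (A.drazinPi * B) 0 0 ^ g = 0) :
    (fromBlocks A B C D).drazinInv = (blockP A B C).drazinInv +
      ∑ k ∈ Finset.range g, (blockP A B C).drazinInv ^ (k + 2) *
        fromBlocks 0 0 (C * A.drazinPi) 0 *
        fromBlocks (A * A.drazinPi) (A.drazinPi * B) 0 0 ^ k := by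
  have hone : A * A.drazinInv + A.drazinPi = 1 := by rw [drazinPi, add_sub_cancel]
  have hD : D = C * A.drazinInv * B := by rwa [schurZ, sub_eq_zero] at hZ
  have hM : fromBlocks A B C D = blockP A B C +
      (fromBlocks (A * A.drazinPi) (A.drazinPi * B) 0 0 +
        fromBlocks 0 0 (C * A.drazinPi) 0) := by
    rw [blockP, fromBlocks_add, fromBlocks_add, hD]
    congr 1
    · rw [add_zero, pow_two, mul_assoc, ← mul_add, hone, mul_one]
    · rw [add_zero, ← Matrix.add_mul, hone, Matrix.one_mul]
    · rw [zero_add, Matrix.mul_assoc, ← Matrix.mul_add, hone, Matrix.mul_one]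
    · simp
  have hPA : A.drazinPi * (A ^ 2 * A.drazinInv) = 0 := by
    rw [pow_two, mul_assoc, ← mul_assoc, ← A.commute_drazinPi.eq, mul_assoc,
      drazinPi_mul_mul_drazinInv, mul_zero]
  have hAP : A ^ 2 * A.drazinInv * A.drazinPi = 0 := by
    rw [mul_assoc, drazinInv_mul_drazinPi, mul_zero]
  have hQ0 : ∀ X : Matrix m m ℂ, A.drazinPi * B * (C * X) = 0 := fun X => by
    rw [← Matrix.mul_assoc, hB, Matrix.zero_mul]
  have hQ1 : ∀ X : Matrix m n ℂ, A.drazinPi * B * (C * X) = 0 := fun X => by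
    rw [← Matrix.mul_assoc, hB, Matrix.zero_mul]
  have hPB : A.drazinPi * (A * A.drazinInv * B) = 0 := by
    rw [← Matrix.mul_assoc, drazinPi_mul_mul_drazinInv, Matrix.zero_mul]
  rw [hM]
  refine drazinInv_add_add ?_ ?_ ?_ hg
  -- The lower blocks of `P` begin with `C` and die by `A^π B C = 0`; the upper ones die by `A^π A
  -- A^d = 0`.
  · rw [blockP, fromBlocks_add, fromBlocks_multiply, Matrix.mul_assoc C A, Matrix.mul_assoc C _ B]
    simp only [add_zero, zero_add, Matrix.zero_mul, hQ0, hQ1, Matrix.mul_assoc A A.drazinPi,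
      Matrix.mul_assoc C A.drazinPi, hPA, hPB, Matrix.mul_zero, fromBlocks_zero]
  · have hAA : A.drazinPi * A = A * A.drazinPi := A.commute_drazinPi.eq.symm
    rw [blockP, fromBlocks_multiply, ← hAA, Matrix.mul_assoc C A]
    simp only [Matrix.mul_zero, add_zero, ← Matrix.mul_assoc (A ^ 2 * A.drazinInv), hAP,
      Matrix.zero_mul, Matrix.mul_assoc C, ← Matrix.mul_assoc (A * A.drazinInv),
      mul_drazinInv_mul_drazinPi, fromBlocks_zero]
  · rw [fromBlocks_add, fromBlocks_multiply]
    simp only [Matrix.mul_zero, add_zero, zero_add, Matrix.zero_mul, hQ0, fromBlocks_zero]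

end Block

end Matrix

theorem corollary4p3 {m n : Type*} [Fintype m] [DecidableEq m] [Fintype n] [DecidableEq n]
    (A : Matrix m m ℂ) (B : Matrix m n ℂ) (C : Matrix n m ℂ) (D : Matrix n n ℂ) :
    -- the explicit form of `P^d`: `[I; C A^d] ((A W)^d)^2 A [I, A^d B]`
    (Matrix.blockP A B C).drazinInv =
      Matrix.fromRows (1 : Matrix m m ℂ) (C * A.drazinInv) *
        (A * Matrix.blockW A B C).drazinInv ^ 2 * A *
        Matrix.fromCols (1 : Matrix m m ℂ) (A.drazinInv * B) ∧
    -- case (i)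
    (Matrix.schurZ A B C D = 0 ∧ A.drazinPi * B * C = 0 →
      ∀ g : ℕ, g = A.drazinIndex + 1 →
        (Matrix.fromBlocks A B C D).drazinInv =
          (Matrix.blockP A B C).drazinInv +
            ∑ k ∈ Finset.range g, (Matrix.blockP A B C).drazinInv ^ (k + 2) *
              Matrix.fromBlocks 0 0 (C * A.drazinPi) 0 *
              Matrix.fromBlocks (A * A.drazinPi) (A.drazinPi * B) 0 0 ^ k) ∧
    -- case (ii)
    (Matrix.schurZ A B C D = 0 ∧ A.drazinPi * B = 0 →
      ∀ g : ℕ, g = A.drazinIndex →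
        (Matrix.fromBlocks A B C D).drazinInv =
          (Matrix.blockP A B C).drazinInv +
            ∑ k ∈ Finset.range g, (Matrix.blockP A B C).drazinInv ^ (k + 2) *
              Matrix.fromBlocks 0 0 (C * A.drazinPi * A ^ k) 0) := by
  refine ⟨Matrix.drazinInv_blockP A B C, ?_, ?_⟩
  · rintro ⟨hZ, hB⟩ g rfl
    refine Matrix.drazinInv_fromBlocks hZ hB ?_
    rw [Matrix.fromBlocks_drazinPi_pow_eq_zero, mul_zero]
  · rintro ⟨hZ, hB⟩ g rfl
    have hp := Matrix.fromBlocks_drazinPi_pow_eq_zero A B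
    have hc : A.drazinPi * A ^ A.drazinIndex = 0 := by
      rw [← (A.commute_drazinPi.pow_left _).eq, Matrix.pow_drazinIndex_mul_drazinPi]
    -- One term fewer suffices: `Q Q₁^g = Q₁^(g+1) + Q₂ Q₁^g`, and with `A^π B = 0` the second
    -- summand has the single block `C A^π A^g`, which is already zero at `g = ind(A)`.
    have h := Matrix.drazinInv_fromBlocks hZ (by rw [hB, Matrix.zero_mul]) (g := A.drazinIndex) (by
      rw [add_mul, ← pow_succ', hp, zero_add, hB, Matrix.fromBlocks_mul_fromBlocks_drazinPi_pow,
        Matrix.mul_assoc, hc, Matrix.mul_zero, Matrix.fromBlocks_zero])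
    simpa only [hB, mul_assoc, Matrix.fromBlocks_mul_fromBlocks_drazinPi_pow] using h
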